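/- Let $\mathbb K\in\{\mathbb R,\mathbb C\}$ and let $\mathbb M_{n_1,n_2}$ be the space of $n_1\times n_2$ matrices over $\mathbb K$ with the Frobenius norm $\|\cdot\|$. Let $H$ be a finite-dimensional real inner product space (for instance $\mathbb R^m$ or $\mathbb C^m$ with the Euclidean norm), let $\mathcal A:\mathbb M_{n_1,n_2}\to H$ be an $\mathbb R$-linear operator with operator norm $\|\mathcal A\|$, and let $K\ge 1$. For a matrix $X$ let $\sigma_1(X)\ge\sigma_2(X)\ge\dots$ be its singular values, and define $\delta_{2K}^-$ by $$1-\delta_{2K}^-=\inf\Big\{\frac{\|\mathcal A X\|^2}{\|X\|^2}:\ X\ne 0,\ \operatorname{rank}X\le 2K\Big\}.$$ Put $\iota_{R_K}(X)=0$ if $\operatorname{rank}X\le K$ and $\iota_{R_K}(X)=\infty$ otherwise. For $f:\mathbb M_{n_1,n_2}\to[-\infty,\infty]$ let $\mathcal S_2(f)(Y)=\sup_X\big(-f(X)-\|X-Y\|^2\big)$, and let $\mathcal Q_2=\mathcal S_2\circ\mathcal S_2$ (the quadratic envelope). **Theorem.** Suppose that $b=\mathcal A X_0+\epsilon$ with $X_0\in\mathbb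 M_{n_1,n_2}$ and $\epsilon\in H$, that $\|\mathcal A\|<1$, $\delta_{2K}^-<1/2$, $\operatorname{rank}X_0=K$, and that $$\sigma_K(X_0)>\frac{5}{(1-2\delta_{2K}^-)^{3/2}}\,\|\epsilon\|.$$ Then the problem $\operatorname{argmin}_{\operatorname{rank}X\le K}\|\mathcal A X-b\|$ has a unique solution $X_B$ (the best rank $K$ solution). Moreover $X_B$ is the unique global minimizer of $$\mathcal R_{K,reg}(X)=\mathcal Q_2(\iota_{R_K})(X)+\|\mathcal A X-b\|^2,\qquad X\in\mathbb M_{n_1,n_2},$$ this functional has no local minimizer other than $X_B$, and $$\|X_B-X_0\|\le\frac{2\|\epsilon\|}{\sqrt{1-\delta_{2K}^-}}.$$ -/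

import Mathlib

open scoped Topology

-- Matrices carry the Frobenius norm throughout.
attribute [local instance] Matrix.frobeniusNormedAddCommGroup Matrix.frobeniusNormedSpace

noncomputable section

namespace LowRank

/-- The transform `S_γ(f)(Y) = sup_X (-f(X) - (γ/2)‖X - Y‖²)` of an extended-real-valued function. -/
def quadTransform {V : Type*} [NormedAddCommGroup V] (γ : ℝ) (f : V → EReal) (Y : V) : EReal :=
  ⨆ X : V, (-f X - ((γ / 2 * ‖X - Y‖ ^ 2 : ℝ) : EReal))

/-- The quadratic envelope `Q_γ(f) = S_γ(S_γ(f))`. -/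
def quadEnvelope {V : Type*} [NormedAddCommGroup V] (γ : ℝ) (f : V → EReal) : V → EReal :=
  quadTransform γ (quadTransform γ f)

/-- The operator norm of a linear map on a finite-dimensional normed space. -/
def opNorm {V W : Type*} [NormedAddCommGroup V] [NormedSpace ℝ V] [FiniteDimensional ℝ V]
    [NormedAddCommGroup W] [NormedSpace ℝ W] (A : V →ₗ[ℝ] W) : ℝ :=
  ‖LinearMap.toContinuousLinearMap A‖

variable {𝕜 : Type*} [RCLike 𝕜] {n₁ n₂ : ℕ}

open Classical in
/-- The indicator functional `ι_{R_K}`: `0` on matrices of rank at most `K`, and `∞` elsewhere. -/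
def rankIndicator (K : ℕ) (X : Matrix (Fin n₁) (Fin n₂) 𝕜) : EReal :=
  if X.rank ≤ K then 0 else ⊤

/-- The `j`-th largest singular value `σ_j(X)`, `j = 1, 2, …` (Mathlib's sequence starts at `0`). -/
def sigma (X : Matrix (Fin n₁) (Fin n₂) 𝕜) (j : ℕ) : ℝ :=
  (Matrix.toEuclideanLin X).singularValues (j - 1)

variable {H : Type*} [NormedAddCommGroup H] [InnerProductSpace ℝ H]

/-- The lower restricted isometry constant `δ_k⁻`, defined by
`1 - δ_k⁻ = inf {‖A X‖² / ‖X‖² : X ≠ 0, rank X ≤ k}`. -/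
def lrip (A : Matrix (Fin n₁) (Fin n₂) 𝕜 →ₗ[ℝ] H) (k : ℕ) : ℝ :=
  1 - sInf {r : ℝ | ∃ X : Matrix (Fin n₁) (Fin n₂) 𝕜,
    X ≠ 0 ∧ X.rank ≤ k ∧ r = ‖A X‖ ^ 2 / ‖X‖ ^ 2}

/-- `X` solves the best rank `K` problem `argmin_{rank X ≤ K} ‖A X - b‖`. -/
def IsBestRank (A : Matrix (Fin n₁) (Fin n₂) 𝕜 →ₗ[ℝ] H) (b : H) (K : ℕ)
    (X : Matrix (Fin n₁) (Fin n₂) 𝕜) : Prop :=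
  X.rank ≤ K ∧ ∀ Y : Matrix (Fin n₁) (Fin n₂) 𝕜, Y.rank ≤ K → ‖A X - b‖ ≤ ‖A Y - b‖

/-- The regularized functional `Q_2(ι_{R_K})(X) + ‖A X - b‖²`. -/
def regFunctional (A : Matrix (Fin n₁) (Fin n₂) 𝕜 →ₗ[ℝ] H) (b : H) (K : ℕ)
    (X : Matrix (Fin n₁) (Fin n₂) 𝕜) : EReal :=
  quadEnvelope 2 (rankIndicator K) X + ((‖A X - b‖ ^ 2 : ℝ) : EReal)

end LowRank

end

/-!
The quadratic envelope of the indicator functional of a closed set `C` is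
`Q₂(ι_C)(Y) = sup_Z (dist(Z, C)² - ‖Z - Y‖²)`. It vanishes on `C`, and its excess over the chord is
at most `s t ‖X - Y‖²` at `s X + t Y`. Since `A` is a strict contraction, testing with
`Z = Y - A*(A Y - b)` shows that the best solutions are global minimizers, and moving from a local
minimizer `Y` towards the point of `C` nearest to `Z` shows that `Y` is itself that point: `Y ∈ C`
and `E = -A*(A Y - b)` is a proximal normal to `C` at `Y`.

For matrices of bounded rank, a proximal normal at `X` is orthogonal to the row and column spaces
of `X`, so by Eckart–Young it may be lengthened as long as its norm stays below the least nonzero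
singular value of `X`. At a best solution `X`, the hypothesis on `σ_K(X₀)` allows a factor
`τ > 1/(1 - 2δ)`. Adding the proximal inequalities of `X` and of a local minimizer `Y` then gives
`2τ‖A (Y - X)‖² ≤ (1 + τ)‖Y - X‖²`, whereas `‖A (Y - X)‖² ≥ (1 - δ)‖Y - X‖²`; hence `Y = X`.
-/

namespace LowRank

open Metric Set

section Envelope

variable {V : Type*} [NormedAddCommGroup V] {C : Set V} {X Y : V}

open Classical in
/-- The indicator functional `ι_C`: `0` on `C` and `∞` elsewhere. -/
noncomputable def setIndicator (C : Set V) (X : V) : EReal :=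
  if X ∈ C then 0 else ⊤

theorem infDist_sq_le_norm_sub_sq (hX : X ∈ C) (Z : V) : infDist Z C ^ 2 ≤ ‖Z - X‖ ^ 2 := by
  rw [← dist_eq_norm]
  exact pow_le_pow_left₀ infDist_nonneg (infDist_le_dist_of_mem hX) 2

theorem quadTransform_setIndicator [ProperSpace V] (hC : IsClosed C) (hne : C.Nonempty) (Y : V) :
    quadTransform 2 (setIndicator C) Y = ((-infDist Y C ^ 2 : ℝ) : EReal) := by
  refine le_antisymm (iSup_le fun X ↦ ?_) ?_
  · by_cases hX : X ∈ C
    · rw [setIndicator, if_pos hX, neg_zero, zero_sub, ← EReal.coe_neg, EReal.coe_le_coe_iff,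
        norm_sub_rev]
      linarith [infDist_sq_le_norm_sub_sq hX Y]
    · rw [setIndicator, if_neg hX, EReal.neg_top, EReal.bot_sub]
      exact bot_le
  · obtain ⟨X, hX, h⟩ := hC.exists_infDist_eq_dist hne Y
    refine le_iSup_of_le X ?_
    rw [setIndicator, if_pos hX, neg_zero, zero_sub, ← EReal.coe_neg, h, dist_comm, dist_eq_norm,
      div_self two_ne_zero, one_mul]

theorem quadEnvelope_setIndicator [ProperSpace V] (hC : IsClosed C) (hne : C.Nonempty) (Y : V) :
    quadEnvelope 2 (setIndicator C) Y =
      ⨆ Z, ((infDist Z C ^ 2 - ‖Z - Y‖ ^ 2 : ℝ) : EReal) := by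
  refine iSup_congr fun Z ↦ ?_
  rw [quadTransform_setIndicator hC hne, ← EReal.coe_neg, ← EReal.coe_sub, neg_neg,
    div_self two_ne_zero, one_mul]

theorem quadEnvelope_setIndicator_le_iff [ProperSpace V] (hC : IsClosed C) (hne : C.Nonempty)
    {a : ℝ} :
    quadEnvelope 2 (setIndicator C) Y ≤ a ↔ ∀ Z, infDist Z C ^ 2 - ‖Z - Y‖ ^ 2 ≤ a := by
  simp only [quadEnvelope_setIndicator hC hne, iSup_le_iff, EReal.coe_le_coe_iff]

theorem le_quadEnvelope_setIndicator [ProperSpace V] (hC : IsClosed C) (hne : C.Nonempty)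
    (Z Y : V) :
    ((infDist Z C ^ 2 - ‖Z - Y‖ ^ 2 : ℝ) : EReal) ≤ quadEnvelope 2 (setIndicator C) Y := by
  rw [quadEnvelope_setIndicator hC hne]
  exact le_iSup (fun Z ↦ ((infDist Z C ^ 2 - ‖Z - Y‖ ^ 2 : ℝ) : EReal)) Z

theorem quadEnvelope_setIndicator_nonneg [ProperSpace V] (hC : IsClosed C) (hne : C.Nonempty)
    (Y : V) : 0 ≤ quadEnvelope 2 (setIndicator C) Y := by
  refine le_trans ?_ (le_quadEnvelope_setIndicator hC hne Y Y)
  rw [sub_self, norm_zero, zero_pow two_ne_zero, sub_zero, ← EReal.coe_zero,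
    EReal.coe_le_coe_iff]
  exact sq_nonneg _

theorem quadEnvelope_setIndicator_of_mem [ProperSpace V] (hC : IsClosed C) (hX : X ∈ C) :
    quadEnvelope 2 (setIndicator C) X = 0 :=
  le_antisymm ((quadEnvelope_setIndicator_le_iff hC ⟨X, hX⟩ (a := 0)).2 fun Z ↦
      sub_nonpos.2 (infDist_sq_le_norm_sub_sq hX Z))
    (quadEnvelope_setIndicator_nonneg hC ⟨X, hX⟩ X)

end Envelope

section InnerProduct

variable {V : Type*} [NormedAddCommGroup V] [InnerProductSpace ℝ V] {C : Set V} {X Y : V}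

theorem norm_sub_smul_add_smul_sq (x y z : V) {s t : ℝ} (hst : s + t = 1) :
    ‖z - (s • x + t • y)‖ ^ 2
      = s * ‖z - x‖ ^ 2 + t * ‖z - y‖ ^ 2 - s * t * ‖x - y‖ ^ 2 := by
  obtain rfl : t = 1 - s := by linarith
  have hz : z - (s • x + (1 - s) • y) = (z - y) - s • (x - y) := by module
  have hx : z - x = (z - y) - (x - y) := by module
  rw [hz, hx, norm_sub_sq_real (z - y), norm_sub_sq_real (z - y), real_inner_smul_right,
    norm_smul, mul_pow, Real.norm_eq_abs, sq_abs]
  ring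

/-- `E` is a proximal normal to `C` at `X`: no point of `C` is closer to `X + E` than `X` is. -/
def IsProximalNormal (C : Set V) (X E : V) : Prop :=
  ∀ W ∈ C, ‖E‖ ≤ ‖X + E - W‖

theorem IsProximalNormal.two_mul_inner_le {E W : V} (h : IsProximalNormal C X E) (hW : W ∈ C) :
    2 * inner ℝ E (W - X) ≤ ‖W - X‖ ^ 2 := by
  have hle := pow_le_pow_left₀ (norm_nonneg _) (h W hW) 2
  rw [show X + E - W = E - (W - X) by module, norm_sub_sq_real] at hle
  linarith

theorem IsProximalNormal.inner_eq_zero {E D : V} (h : IsProximalNormal C X E)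
    (hD : ∀ s : ℝ, X + s • D ∈ C) : inner ℝ E D = 0 := by
  have hquad : ∀ s : ℝ, 0 ≤ ‖D‖ ^ 2 * (s * s) + (-2 * inner ℝ E D) * s + 0 := by
    intro s
    have hs := h.two_mul_inner_le (hD s)
    rw [add_sub_cancel_left, inner_smul_right, norm_smul, mul_pow, Real.norm_eq_abs, sq_abs] at hs
    linarith
  have hdiscrim := discrim_le_zero hquad
  rw [discrim] at hdiscrim
  nlinarith

theorem norm_map_sub_sq_eq {H : Type*} [NormedAddCommGroup H] [InnerProductSpace ℝ H]
    (A : V →ₗ[ℝ] H) (b : H) (Y W : V) :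
    ‖A W - b‖ ^ 2
      = ‖A Y - b‖ ^ 2 + 2 * inner ℝ (A Y - b) (A (W - Y)) + ‖A (W - Y)‖ ^ 2 := by
  rw [← norm_add_sq_real, map_sub]
  congr 2
  abel

theorem quadEnvelope_setIndicator_smul_add_smul_le [ProperSpace V] (hC : IsClosed C)
    (hne : C.Nonempty) {p q s t : ℝ} (hX : quadEnvelope 2 (setIndicator C) X ≤ p)
    (hY : quadEnvelope 2 (setIndicator C) Y ≤ q) (hs : 0 ≤ s) (ht : 0 ≤ t) (hst : s + t = 1) :
    quadEnvelope 2 (setIndicator C) (s • X + t • Y)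
      ≤ ((s * p + t * q + s * t * ‖X - Y‖ ^ 2 : ℝ) : EReal) := by
  rw [quadEnvelope_setIndicator_le_iff hC hne] at hX hY ⊢
  intro Z
  rw [norm_sub_smul_add_smul_sq X Y Z hst]
  have hZX := mul_le_mul_of_nonneg_left (hX Z) hs
  have hZY := mul_le_mul_of_nonneg_left (hY Z) ht
  linear_combination hZX + hZY - infDist Z C ^ 2 * hst

theorem exists_quadEnvelope_setIndicator_eq_coe [ProperSpace V] (hC : IsClosed C)
    (hX : X ∈ convexHull ℝ C) : ∃ p : ℝ, quadEnvelope 2 (setIndicator C) X = p := by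
  have hne : C.Nonempty := convexHull_nonempty_iff.1 ⟨X, hX⟩
  have hfinite : ∃ p : ℝ, quadEnvelope 2 (setIndicator C) X ≤ p := by
    refine convexHull_min (t := {X | ∃ p : ℝ, quadEnvelope 2 (setIndicator C) X ≤ p})
      (fun W hW ↦ ⟨0, (quadEnvelope_setIndicator_of_mem hC hW).le⟩) ?_ hX
    rintro X ⟨p, hp⟩ Y ⟨q, hq⟩ s t hs ht hst
    exact ⟨_, quadEnvelope_setIndicator_smul_add_smul_le hC hne hp hq hs ht hst⟩
  obtain ⟨p, hp⟩ := hfinite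
  refine ⟨_, (EReal.coe_toReal (ne_top_of_le_ne_top (EReal.coe_ne_top p) hp) ?_).symm⟩
  exact ((EReal.bot_lt_zero).trans_le (quadEnvelope_setIndicator_nonneg hC hne X)).ne'

end InnerProduct

section LeastSquares

variable {V : Type*} [NormedAddCommGroup V] [InnerProductSpace ℝ V] [FiniteDimensional ℝ V]
  {H : Type*} [NormedAddCommGroup H] [InnerProductSpace ℝ H]
  {C : Set V} {A : V →ₗ[ℝ] H} {b : H} {X Y : V}

/-- The functional `Q₂(ι_C)(X) + ‖A X - b‖²`. -/
noncomputable def envelopeLeastSquares (C : Set V) (A : V →ₗ[ℝ] H) (b : H) (X : V) : EReal :=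
  quadEnvelope 2 (setIndicator C) X + ((‖A X - b‖ ^ 2 : ℝ) : EReal)

/-- The steepest descent direction `-A*(A X - b)` of `½‖A X - b‖²` at `X`, expressed by the Riesz
representation on `V` because `H` need not be complete. -/
noncomputable def descentDir (A : V →ₗ[ℝ] H) (b : H) (X : V) : V :=
  (InnerProductSpace.toDual ℝ V).symm
    (-LinearMap.toContinuousLinearMap ((innerₗ H (A X - b)) ∘ₗ A))

theorem inner_descentDir (A : V →ₗ[ℝ] H) (b : H) (X D : V) :
    inner ℝ (descentDir A b X) D = -inner ℝ (A X - b) (A D) := by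
  simp [descentDir, inner_sub_left]

theorem norm_descentDir_le (hA : ∀ D, ‖A D‖ ≤ ‖D‖) (b : H) (X : V) :
    ‖descentDir A b X‖ ≤ ‖A X - b‖ := by
  rcases (norm_nonneg (descentDir A b X)).eq_or_lt with h | h
  · exact h ▸ norm_nonneg _
  refine le_of_mul_le_mul_right ?_ h
  calc ‖descentDir A b X‖ * ‖descentDir A b X‖
      = inner ℝ (-(A X - b)) (A (descentDir A b X)) := by
        rw [← real_inner_self_eq_norm_mul_norm, inner_descentDir, inner_neg_left]
    _ ≤ ‖A X - b‖ * ‖A (descentDir A b X)‖ := by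
        simpa only [norm_neg] using real_inner_le_norm (-(A X - b)) (A (descentDir A b X))
    _ ≤ ‖A X - b‖ * ‖descentDir A b X‖ := mul_le_mul_of_nonneg_left (hA _) (norm_nonneg _)

theorem norm_add_descentDir_sub_sq (A : V →ₗ[ℝ] H) (b : H) (Y W : V) :
    ‖Y + descentDir A b Y - W‖ ^ 2 - ‖Y + descentDir A b Y - Y‖ ^ 2
      = ‖W - Y‖ ^ 2 + 2 * inner ℝ (A Y - b) (A (W - Y)) := by
  rw [add_sub_cancel_left, show Y + descentDir A b Y - W = descentDir A b Y - (W - Y) by module,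
    norm_sub_sq_real, inner_descentDir]
  ring

theorem envelopeLeastSquares_of_mem (hC : IsClosed C) (hX : X ∈ C) :
    envelopeLeastSquares C A b X = ((‖A X - b‖ ^ 2 : ℝ) : EReal) := by
  rw [envelopeLeastSquares, quadEnvelope_setIndicator_of_mem hC hX, zero_add]

theorem envelopeLeastSquares_le_of_forall_le (hC : IsClosed C) (hA : ∀ D, ‖A D‖ ≤ ‖D‖)
    (hX : X ∈ C) (hmin : ∀ W ∈ C, ‖A X - b‖ ≤ ‖A W - b‖) (Y : V) :
    envelopeLeastSquares C A b X ≤ envelopeLeastSquares C A b Y := by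
  set Z := Y + descentDir A b Y
  have hZ : ‖A X - b‖ ^ 2 - ‖A Y - b‖ ^ 2 ≤ infDist Z C ^ 2 - ‖Z - Y‖ ^ 2 := by
    obtain ⟨W, hW, hZW⟩ := hC.exists_infDist_eq_dist ⟨X, hX⟩ Z
    rw [hZW, dist_eq_norm, norm_add_descentDir_sub_sq]
    have hXW := pow_le_pow_left₀ (norm_nonneg _) (hmin W hW) 2
    have hD := pow_le_pow_left₀ (norm_nonneg _) (hA (W - Y)) 2
    linarith [norm_map_sub_sq_eq A b Y W]
  calc envelopeLeastSquares C A b X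
      = ((‖A X - b‖ ^ 2 : ℝ) : EReal) := envelopeLeastSquares_of_mem hC hX
    _ ≤ ((infDist Z C ^ 2 - ‖Z - Y‖ ^ 2 + ‖A Y - b‖ ^ 2 : ℝ) : EReal) := by
      rw [EReal.coe_le_coe_iff]
      linarith
    _ ≤ envelopeLeastSquares C A b Y := by
      rw [EReal.coe_add]
      exact add_le_add_left (le_quadEnvelope_setIndicator hC ⟨X, hX⟩ Z Y) _

/-- Moving from a local minimizer `Y` towards `W ∈ C` bounds the envelope at `Y` from above; the
strict contractivity of `A` makes the last term a genuine gain. -/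
theorem exists_pos_le_of_isLocalMin (hC : IsClosed C) {p : ℝ}
    (hp : quadEnvelope 2 (setIndicator C) Y = p)
    (hY : IsLocalMin (envelopeLeastSquares C A b) Y) {W : V} (hW : W ∈ C) :
    ∃ t : ℝ, 0 < t ∧
      p ≤ ‖W - Y‖ ^ 2 + 2 * inner ℝ (A Y - b) (A (W - Y))
        - t * (‖W - Y‖ ^ 2 - ‖A (W - Y)‖ ^ 2) := by
  have hcont : Filter.Tendsto (fun t : ℝ ↦ (1 - t) • Y + t • W) (𝓝[>] 0) (𝓝 Y) := by
    have : Continuous fun t : ℝ ↦ (1 - t) • Y + t • W := by fun_prop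
    simpa using (this.tendsto 0).mono_left nhdsWithin_le_nhds
  obtain ⟨t, hlocal, ht0, ht1⟩ :=
    ((hcont.eventually hY).and (Ioo_mem_nhdsGT zero_lt_one)).exists
  refine ⟨t, ht0, ?_⟩
  have henv := quadEnvelope_setIndicator_smul_add_smul_le hC ⟨W, hW⟩ hp.le
    (quadEnvelope_setIndicator_of_mem hC hW).le (sub_nonneg.2 ht1.le) ht0.le (sub_add_cancel 1 t)
  have hfit : ‖A ((1 - t) • Y + t • W) - b‖ ^ 2
      = (1 - t) * ‖A Y - b‖ ^ 2 + t * ‖A W - b‖ ^ 2 - (1 - t) * t * ‖A (W - Y)‖ ^ 2 := by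
    rw [norm_sub_rev, map_add, map_smul, map_smul,
      norm_sub_smul_add_smul_sq _ _ _ (sub_add_cancel 1 t), ← map_sub, ← norm_neg (A (Y - W)),
      ← map_neg, neg_sub, norm_sub_rev b, norm_sub_rev b]
  have hreal : p + ‖A Y - b‖ ^ 2
      ≤ ((1 - t) * p + t * 0 + (1 - t) * t * ‖Y - W‖ ^ 2)
        + ‖A ((1 - t) • Y + t • W) - b‖ ^ 2 := by
    rw [envelopeLeastSquares, hp] at hlocal
    exact_mod_cast hlocal.trans (add_le_add_left henv _)
  rw [hfit, norm_map_sub_sq_eq A b Y W, norm_sub_rev Y W] at hreal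
  refine le_of_mul_le_mul_left ?_ ht0
  linarith

theorem mem_and_isProximalNormal_of_isLocalMin (hC : IsClosed C) (hhull : convexHull ℝ C = univ)
    (hA : ∀ D ≠ 0, ‖A D‖ < ‖D‖) (hY : IsLocalMin (envelopeLeastSquares C A b) Y) :
    Y ∈ C ∧ IsProximalNormal C Y (descentDir A b Y) := by
  have hYhull : Y ∈ convexHull ℝ C := hhull ▸ mem_univ Y
  have hne : C.Nonempty := convexHull_nonempty_iff.1 ⟨Y, hYhull⟩
  obtain ⟨p, hp⟩ := exists_quadEnvelope_setIndicator_eq_coe hC hYhull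
  set Z := Y + descentDir A b Y
  obtain ⟨W, hW, hZW⟩ := hC.exists_infDist_eq_dist hne Z
  rw [dist_eq_norm] at hZW
  have hp_ge := (quadEnvelope_setIndicator_le_iff hC hne).1 hp.le Z
  obtain ⟨t, ht, hp_le⟩ := exists_pos_le_of_isLocalMin hC hp hY hW
  rw [hZW, norm_add_descentDir_sub_sq] at hp_ge
  have hWY : W = Y := by
    by_contra h
    have hgain : 0 < t * (‖W - Y‖ ^ 2 - ‖A (W - Y)‖ ^ 2) :=
      mul_pos ht (sub_pos.2 (pow_lt_pow_left₀ (hA _ (sub_ne_zero.2 h)) (norm_nonneg _) two_ne_zero))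
    linarith
  subst hWY
  refine ⟨hW, fun W' hW' ↦ ?_⟩
  calc ‖descentDir A b W‖ = infDist Z C := by rw [hZW, add_sub_cancel_left]
    _ ≤ dist Z W' := infDist_le_dist_of_mem hW'
    _ = ‖Z - W'‖ := dist_eq_norm Z W'

/-- Adding the two proximal inequalities, the inner products telescope to
`2 ‖A (Y - X)‖²`. -/
theorem eq_of_isProximalNormal {c τ : ℝ} (hX : X ∈ C) (hY : Y ∈ C)
    (hnX : IsProximalNormal C X (τ • descentDir A b X))
    (hnY : IsProximalNormal C Y (descentDir A b Y))
    (hc : c * ‖Y - X‖ ^ 2 ≤ ‖A (Y - X)‖ ^ 2) (hτ : 0 ≤ τ) (hτc : 1 < τ * (2 * c - 1)) : Y = X := by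
  by_contra hne
  have hpos : 0 < ‖Y - X‖ ^ 2 := by
    have := norm_pos_iff.2 (sub_ne_zero.2 hne)
    positivity
  have hXY := hnX.two_mul_inner_le hY
  have hYX := hnY.two_mul_inner_le hX
  rw [inner_smul_left, inner_descentDir] at hXY
  rw [inner_descentDir, ← neg_sub Y X, norm_neg, map_neg, inner_neg_right] at hYX
  have htele : inner ℝ (A Y - b) (A (Y - X))
      = inner ℝ (A X - b) (A (Y - X)) + ‖A (Y - X)‖ ^ 2 := by
    rw [← real_inner_self_eq_norm_sq, ← inner_add_left, map_sub]
    congr 1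
    abel
  simp only [conj_trivial] at hXY
  have hYX' : τ * (2 * inner ℝ (A Y - b) (A (Y - X))) ≤ τ * ‖Y - X‖ ^ 2 :=
    mul_le_mul_of_nonneg_left (by linarith) hτ
  have hcτ := mul_le_mul_of_nonneg_left hc hτ
  have hgap := mul_lt_mul_of_pos_right hτc hpos
  rw [htele] at hYX'
  linarith

end LeastSquares

section RowSpace

open Matrix

variable {𝕜 : Type*} [RCLike 𝕜] {m n p : Type*} [Fintype n]

theorem rank_eq_finrank_range_toEuclideanLin [DecidableEq n] [Finite m] (X : Matrix m n 𝕜) :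
    X.rank = Module.finrank 𝕜 (LinearMap.range (toEuclideanLin X)) := by
  cases nonempty_fintype m
  classical
  rw [rank_eq_finrank_range_toLin X (PiLp.basisFun 2 𝕜 m) (PiLp.basisFun 2 𝕜 n),
    ← toLpLin_eq_toLin 2 2]

theorem rank_sub_le [Finite m] (X Y : Matrix m n 𝕜) : (X - Y).rank ≤ X.rank + Y.rank := by
  classical
  simp only [rank_eq_finrank_range_toEuclideanLin]
  refine le_trans (Submodule.finrank_mono ?_) (Submodule.finrank_add_le_finrank_add_finrank _ _)
  rintro _ ⟨v, rfl⟩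
  rw [map_sub, LinearMap.sub_apply]
  exact Submodule.sub_mem _ (Submodule.mem_sup_left ⟨v, rfl⟩) (Submodule.mem_sup_right ⟨v, rfl⟩)

variable [DecidableEq n]

theorem finrank_ker_toEuclideanLin_orthogonal [Finite m] (X : Matrix m n 𝕜) :
    Module.finrank 𝕜 (LinearMap.ker (toEuclideanLin X))ᗮ = X.rank := by
  have hker := Submodule.finrank_add_finrank_orthogonal (LinearMap.ker (toEuclideanLin X))
  have hrange := LinearMap.finrank_range_add_finrank_ker (toEuclideanLin X)
  rw [rank_eq_finrank_range_toEuclideanLin]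
  omega

/-- The matrix of the orthogonal projection onto the row space of `X`, the latter encoded as the
orthogonal complement of the kernel. -/
noncomputable def rowProj (X : Matrix m n 𝕜) : Matrix n n 𝕜 :=
  (toEuclideanCLM (𝕜 := 𝕜)).symm (LinearMap.ker (toEuclideanLin X))ᗮ.starProjection

theorem toEuclideanLin_rowProj_apply (X : Matrix m n 𝕜) (v : EuclideanSpace 𝕜 n) :
    toEuclideanLin (rowProj X) v = (LinearMap.ker (toEuclideanLin X))ᗮ.starProjection v := by
  rw [← coe_toEuclideanCLM_eq_toEuclideanLin, rowProj, StarAlgEquiv.apply_symm_apply]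
  rfl

theorem isStarProjection_rowProj (X : Matrix m n 𝕜) : IsStarProjection (rowProj X) := by
  have hP : IsStarProjection (LinearMap.ker (toEuclideanLin X))ᗮ.starProjection :=
    isStarProjection_starProjection
  refine ⟨?_, ?_⟩
  · rw [IsIdempotentElem, rowProj, ← map_mul, hP.isIdempotentElem.eq]
  · exact ((toEuclideanCLM (𝕜 := 𝕜)).symm.map_star' _).symm.trans
      (congrArg _ hP.isSelfAdjoint.star_eq)

theorem mul_rowProj (X : Matrix m n 𝕜) : X * rowProj X = X := by
  apply toEuclideanLin.injective
  ext1 v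
  have h := Submodule.sub_starProjection_mem_orthogonal
    (K := (LinearMap.ker (toEuclideanLin X))ᗮ) v
  rw [Submodule.orthogonal_orthogonal, LinearMap.mem_ker, map_sub, sub_eq_zero] at h
  rw [toLpLin_mul_same, LinearMap.comp_apply, toEuclideanLin_rowProj_apply, h]

theorem mul_rowProj_eq_zero [Finite p] {X : Matrix m n 𝕜} {E : Matrix p n 𝕜} (h : E * Xᴴ = 0) :
    E * rowProj X = 0 := by
  have hX : X * Eᴴ = 0 := by
    rw [← conjTranspose_eq_zero, conjTranspose_mul, conjTranspose_conjTranspose, h]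
  cases nonempty_fintype p
  classical
  rw [← conjTranspose_eq_zero, conjTranspose_mul, ← star_eq_conjTranspose,
    (isStarProjection_rowProj X).isSelfAdjoint.star_eq]
  apply toEuclideanLin.injective
  ext1 v
  rw [toLpLin_mul_same, LinearMap.comp_apply, toEuclideanLin_rowProj_apply, map_zero,
    LinearMap.zero_apply, Submodule.starProjection_apply_eq_zero_iff,
    Submodule.orthogonal_orthogonal, LinearMap.mem_ker, ← LinearMap.comp_apply,
    ← toLpLin_mul_same, hX, map_zero, LinearMap.zero_apply]

theorem trace_rowProj [Finite m] (X : Matrix m n 𝕜) : (rowProj X).trace = (X.rank : 𝕜) := by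
  have hproj : LinearMap.IsProj (LinearMap.ker (toEuclideanLin X))ᗮ
      (toEuclideanLin (rowProj X)) := by
    constructor <;> intro v
    · rw [toEuclideanLin_rowProj_apply]
      exact Submodule.starProjection_apply_mem _ _
    · rw [toEuclideanLin_rowProj_apply]
      exact Submodule.starProjection_eq_self_iff.2
  rw [← trace_toLin_eq (rowProj X) (PiLp.basisFun 2 𝕜 n), ← toLpLin_eq_toLin 2 2, hproj.trace,
    finrank_ker_toEuclideanLin_orthogonal]

end RowSpace

section Frobenius

open Matrix

variable {𝕜 : Type*} [RCLike 𝕜] {m n p : Type*} [Fintype m] [Fintype n] [Fintype p]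

theorem frobenius_norm_sq (X : Matrix m n 𝕜) : ‖X‖ ^ 2 = ∑ i, ∑ j, ‖X i j‖ ^ 2 := by
  rw [frobenius_norm_def, ← Real.sqrt_eq_rpow, Real.sq_sqrt (by positivity)]
  simp only [Real.rpow_ofNat]

theorem re_trace_conjTranspose_mul_self (X : Matrix m n 𝕜) :
    RCLike.re (Xᴴ * X).trace = ‖X‖ ^ 2 := by
  rw [frobenius_norm_sq, Finset.sum_comm]
  simp only [trace, diag_apply, mul_apply, conjTranspose_apply, map_sum]
  refine Finset.sum_congr rfl fun j _ ↦ Finset.sum_congr rfl fun i _ ↦ ?_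
  rw [RCLike.star_def, RCLike.conj_mul]
  norm_cast

/-- The real inner product `Re tr(Xᴴ Y)` inducing the Frobenius norm. -/
@[reducible]
noncomputable def frobeniusInnerProductSpace : InnerProductSpace ℝ (Matrix m n 𝕜) :=
  { (frobeniusNormedSpace : NormedSpace ℝ (Matrix m n 𝕜)) with
    inner := fun X Y ↦ RCLike.re (Xᴴ * Y).trace
    norm_sq_eq_re_inner := fun X ↦ by
      simpa using (re_trace_conjTranspose_mul_self X).symm
    conj_inner_symm := fun X Y ↦ by
      simp only [conj_trivial]
      rw [← RCLike.conj_re (Yᴴ * X).trace, ← RCLike.star_def, ← trace_conjTranspose,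
        conjTranspose_mul, conjTranspose_conjTranspose]
    add_left := fun X Y Z ↦ by
      simp [Matrix.add_mul]
    smul_left := fun X Y r ↦ by
      simp [RCLike.smul_re] }

attribute [local instance] frobeniusInnerProductSpace

theorem frobenius_inner_eq (X Y : Matrix m n 𝕜) : inner ℝ X Y = RCLike.re (Xᴴ * Y).trace :=
  rfl

theorem frobenius_norm_sq_eq_sum_col (X : Matrix m n 𝕜) :
    ‖X‖ ^ 2 = ∑ j, ‖WithLp.toLp 2 (X.col j)‖ ^ 2 := by
  rw [frobenius_norm_sq, Finset.sum_comm]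
  simp only [EuclideanSpace.norm_sq_eq, col_apply]

theorem norm_toEuclideanLin_apply_le [DecidableEq n] (X : Matrix m n 𝕜)
    (v : EuclideanSpace 𝕜 n) : ‖toEuclideanLin X v‖ ≤ ‖X‖ * ‖v‖ := by
  have h := frobenius_norm_mul X (replicateCol Unit v.ofLp)
  rwa [← replicateCol_mulVec, frobenius_norm_replicateCol, frobenius_norm_replicateCol] at h

theorem mul_norm_le_norm_mul [DecidableEq n] {X : Matrix m n 𝕜} {B : Matrix n p 𝕜} {α : ℝ}
    (hα : 0 ≤ α)
    (h : ∀ j, α * ‖WithLp.toLp 2 (B.col j)‖ ≤ ‖toEuclideanLin X (WithLp.toLp 2 (B.col j))‖) :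
    α * ‖B‖ ≤ ‖X * B‖ := by
  refine le_of_sq_le_sq ?_ (norm_nonneg _)
  rw [mul_pow, frobenius_norm_sq_eq_sum_col, frobenius_norm_sq_eq_sum_col, Finset.mul_sum]
  refine Finset.sum_le_sum fun j _ ↦ ?_
  rw [← mul_pow]
  exact pow_le_pow_left₀ (by positivity) (h j) 2

theorem norm_sq_add_mul_of_conjTranspose_mul_eq_zero {X E : Matrix m n 𝕜} (h : Xᴴ * E = 0)
    (B : Matrix n p 𝕜) : ‖(X + E) * B‖ ^ 2 = ‖X * B‖ ^ 2 + ‖E * B‖ ^ 2 := by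
  have horth : inner ℝ (X * B) (E * B) = 0 := by
    rw [frobenius_inner_eq, conjTranspose_mul, Matrix.mul_assoc, ← Matrix.mul_assoc Xᴴ, h,
      Matrix.zero_mul, Matrix.mul_zero, trace_zero, map_zero]
  rw [Matrix.add_mul, norm_add_sq_real, horth, mul_zero, add_zero]

section StarProjection

variable {P Q : Matrix n n 𝕜}

theorem norm_mul_comm_of_isStarProjection (hP : IsStarProjection P) (hQ : IsStarProjection Q) :
    ‖P * Q‖ = ‖Q * P‖ := by
  rw [← frobenius_norm_conjTranspose, conjTranspose_mul, ← star_eq_conjTranspose,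
    ← star_eq_conjTranspose, hP.isSelfAdjoint.star_eq, hQ.isSelfAdjoint.star_eq]

variable [DecidableEq n]

theorem norm_sq_mul_add_norm_sq_mul_one_sub (hQ : IsStarProjection Q) (X : Matrix m n 𝕜) :
    ‖X * Q‖ ^ 2 + ‖X * (1 - Q)‖ ^ 2 = ‖X‖ ^ 2 := by
  have horth : inner ℝ (X * Q) (X * (1 - Q)) = 0 := by
    rw [frobenius_inner_eq, conjTranspose_mul, ← star_eq_conjTranspose Q, hQ.isSelfAdjoint.star_eq,
      Matrix.mul_assoc, trace_mul_comm, ← Matrix.mul_assoc, Matrix.mul_assoc _ _ Q,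
      hQ.one_sub_mul_self, Matrix.mul_zero, trace_zero, map_zero]
  conv_rhs => rw [← Matrix.mul_one X, ← add_sub_cancel Q 1, Matrix.mul_add, norm_add_sq_real, horth]
  ring

theorem norm_mul_one_sub_le (hQ : IsStarProjection Q) (X : Matrix m n 𝕜) :
    ‖X * (1 - Q)‖ ≤ ‖X‖ := by
  refine le_of_sq_le_sq ?_ (norm_nonneg _)
  linarith [norm_sq_mul_add_norm_sq_mul_one_sub hQ X, sq_nonneg ‖X * Q‖]

theorem norm_mul_one_sub_le_norm_mul_one_sub (hP : IsStarProjection P) (hQ : IsStarProjection Q)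
    (h : ‖P‖ ≤ ‖Q‖) : ‖P * (1 - Q)‖ ≤ ‖Q * (1 - P)‖ := by
  refine le_of_sq_le_sq ?_ (norm_nonneg _)
  have hPQ := norm_sq_mul_add_norm_sq_mul_one_sub hQ P
  have hQP := norm_sq_mul_add_norm_sq_mul_one_sub hP Q
  rw [norm_mul_comm_of_isStarProjection hP hQ] at hPQ
  linarith [pow_le_pow_left₀ (norm_nonneg _) h 2]

end StarProjection

variable [DecidableEq n]

theorem norm_sq_rowProj {l : Type*} [Finite l] (X : Matrix l n 𝕜) :
    ‖rowProj X‖ ^ 2 = X.rank := by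
  have hQ := isStarProjection_rowProj X
  rw [← re_trace_conjTranspose_mul_self, ← star_eq_conjTranspose, hQ.isSelfAdjoint.star_eq,
    hQ.isIdempotentElem.eq, trace_rowProj, RCLike.natCast_re]

theorem norm_mul_rowProj_le {X : Matrix m n 𝕜} {α : ℝ} (hα : 0 ≤ α)
    (hbound : ∀ v ∈ (LinearMap.ker (toEuclideanLin X))ᗮ, α * ‖v‖ ≤ ‖toEuclideanLin X v‖)
    (B : Matrix n p 𝕜) : α * ‖rowProj X * B‖ ≤ ‖X * B‖ := by
  have h : α * ‖rowProj X * B‖ ≤ ‖X * (rowProj X * B)‖ := by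
    refine mul_norm_le_norm_mul hα fun j ↦ hbound _ ?_
    have hcol : WithLp.toLp 2 ((rowProj X * B).col j)
        = toEuclideanLin (rowProj X) (WithLp.toLp 2 (B.col j)) := rfl
    rw [hcol, toEuclideanLin_rowProj_apply]
    exact Submodule.starProjection_apply_mem _ _
  rwa [← Matrix.mul_assoc, mul_rowProj] at h

end Frobenius

section BoundedBelow

variable {𝕜 : Type*} [RCLike 𝕜]
  {E : Type*} [NormedAddCommGroup E] [InnerProductSpace 𝕜 E]

theorem disjoint_ker_of_norm_le {F : Type*} [NormedAddCommGroup F] [Module 𝕜 F] {T : E →ₗ[𝕜] F}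
    {S : Submodule 𝕜 E} {α : ℝ} (hα : 0 < α) (hS : ∀ v ∈ S, α * ‖v‖ ≤ ‖T v‖) :
    Disjoint S (LinearMap.ker T) := by
  refine Submodule.disjoint_def.2 fun v hv hker ↦ norm_le_zero_iff.1 ?_
  have hv0 := hS v hv
  rw [LinearMap.mem_ker.1 hker, norm_zero] at hv0
  exact nonpos_of_mul_nonpos_right hv0 hα

variable [FiniteDimensional 𝕜 E]

theorem finrank_le_finrank_range_of_norm_le {F : Type*} [NormedAddCommGroup F] [Module 𝕜 F]
    {T : E →ₗ[𝕜] F} {S : Submodule 𝕜 E} {α : ℝ} (hα : 0 < α)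
    (hS : ∀ v ∈ S, α * ‖v‖ ≤ ‖T v‖) :
    Module.finrank 𝕜 S ≤ Module.finrank 𝕜 (LinearMap.range T) := by
  have hdisj := Submodule.finrank_add_finrank_le_of_disjoint (disjoint_ker_of_norm_le hα hS)
  have hker := LinearMap.finrank_range_add_finrank_ker T
  omega

/-- Every vector of `(ker T)ᗮ` is the orthogonal projection of a vector of `S` with the same image
under `T`. -/
theorem norm_le_of_mem_ker_orthogonal {F : Type*} [NormedAddCommGroup F] [Module 𝕜 F]
    {T : E →ₗ[𝕜] F} {S : Submodule 𝕜 E} {α : ℝ} (hα : 0 < α)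
    (hS : ∀ v ∈ S, α * ‖v‖ ≤ ‖T v‖)
    (hdim : Module.finrank 𝕜 (LinearMap.range T) ≤ Module.finrank 𝕜 S)
    {v : E} (hv : v ∈ (LinearMap.ker T)ᗮ) : α * ‖v‖ ≤ ‖T v‖ := by
  have htop : S ⊔ LinearMap.ker T = ⊤ := by
    refine Submodule.eq_top_of_disjoint _ _ ?_ (disjoint_ker_of_norm_le hα hS)
    have hker := LinearMap.finrank_range_add_finrank_ker T
    omega
  obtain ⟨s, hs, k, hk, hsk⟩ := Submodule.mem_sup.1 (htop ▸ Submodule.mem_top : v ∈ S ⊔ _)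
  obtain rfl : s = v - k := eq_sub_of_add_eq hsk
  have hvs : ‖v‖ ≤ ‖v - k‖ := by
    refine le_of_sq_le_sq ?_ (norm_nonneg _)
    rw [norm_sub_sq (𝕜 := 𝕜), Submodule.inner_left_of_mem_orthogonal hk hv, map_zero]
    linarith [sq_nonneg ‖k‖]
  calc α * ‖v‖ ≤ α * ‖v - k‖ := mul_le_mul_of_nonneg_left hvs hα.le
    _ ≤ ‖T (v - k)‖ := hS _ hs
    _ = ‖T v‖ := by rw [map_sub, LinearMap.mem_ker.1 hk, sub_zero]

variable {F : Type*} [NormedAddCommGroup F] [InnerProductSpace 𝕜 F] [FiniteDimensional 𝕜 F]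

theorem norm_apply_sq_eq_sum_singularValues (T : E →ₗ[𝕜] F) (v : E) :
    ‖T v‖ ^ 2 = ∑ i : Fin (Module.finrank 𝕜 E), T.singularValues i ^ 2 *
      ‖inner 𝕜 (T.isSymmetric_adjoint_comp_self.eigenvectorBasis rfl i) v‖ ^ 2 := by
  set b := T.isSymmetric_adjoint_comp_self.eigenvectorBasis rfl
  rw [← inner_self_eq_norm_sq (𝕜 := 𝕜), ← LinearMap.adjoint_inner_right,
    ← LinearMap.comp_apply, ← b.sum_inner_mul_inner, map_sum]
  refine Finset.sum_congr rfl fun i _ ↦ ?_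
  rw [← b.repr_apply_apply ((LinearMap.adjoint T ∘ₗ T) v) i,
    T.isSymmetric_adjoint_comp_self.eigenvectorBasis_apply_self_apply,
    b.repr_apply_apply, ← inner_conj_symm v (b i), mul_left_comm, RCLike.conj_mul,
    T.sq_singularValues_fin rfl i]
  norm_cast

/-- The subspace is spanned by the first `j + 1` right singular vectors. -/
theorem exists_finrank_eq_and_singularValues_mul_norm_le (T : E →ₗ[𝕜] F) {j : ℕ}
    (hj : j < Module.finrank 𝕜 E) :
    ∃ S : Submodule 𝕜 E, Module.finrank 𝕜 S = j + 1 ∧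
      ∀ v ∈ S, T.singularValues j * ‖v‖ ≤ ‖T v‖ := by
  set b := T.isSymmetric_adjoint_comp_self.eigenvectorBasis rfl
  let ι : Fin (j + 1) → Fin (Module.finrank 𝕜 E) := Fin.castLE hj
  refine ⟨Submodule.span 𝕜 (Set.range (b ∘ ι)), ?_, fun v hv ↦ ?_⟩
  · rw [finrank_span_eq_card (b.orthonormal.linearIndependent.comp ι (Fin.castLE_injective hj)),
      Fintype.card_fin]
  have hzero : ∀ i, j < i.val → inner 𝕜 (b i) v = 0 := by
    intro i hi
    have hle : Submodule.span 𝕜 (Set.range (b ∘ ι)) ≤ (Submodule.span 𝕜 {b i})ᗮ := by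
      rw [Submodule.span_le]
      rintro _ ⟨k, rfl⟩
      refine Submodule.mem_orthogonal_singleton_iff_inner_right.2 (b.orthonormal.2 ?_)
      rintro rfl
      exact absurd k.2 (by simpa [ι] using hi)
    exact Submodule.mem_orthogonal_singleton_iff_inner_right.1 (hle hv)
  refine le_of_sq_le_sq ?_ (norm_nonneg _)
  rw [norm_apply_sq_eq_sum_singularValues, mul_pow, ← b.sum_sq_norm_inner_right v, Finset.mul_sum]
  refine Finset.sum_le_sum fun i _ ↦ ?_
  rcases lt_or_ge j i.val with hi | hi
  · simp [hzero i hi, b]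
  · exact mul_le_mul_of_nonneg_right
      (pow_le_pow_left₀ (T.singularValues_nonneg j) (T.singularValues_antitone hi) 2)
      (sq_nonneg _)

end BoundedBelow

section RankApproximation

open Matrix

attribute [local instance] frobeniusInnerProductSpace

variable {𝕜 : Type*} [RCLike 𝕜] {m n : Type*} [Fintype n]

theorem isClosed_setOf_rank_le [Finite m] (K : ℕ) :
    IsClosed {X : Matrix m n 𝕜 | X.rank ≤ K} := by
  cases nonempty_fintype m
  classical
  let Φ : Matrix m n 𝕜 →ₗ[𝕜] EuclideanSpace 𝕜 n →L[𝕜] EuclideanSpace 𝕜 m :=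
    LinearMap.toContinuousLinearMap.toLinearMap ∘ₗ toEuclideanLin.toLinearMap
  have hΦ : Continuous Φ := Φ.continuous_of_finiteDimensional
  rw [← isOpen_compl_iff]
  convert (isOpen_setOfPred_nat_le_rank (K + 1)).preimage hΦ using 1
  ext X
  simp only [mem_compl_iff, mem_ofPred_eq, mem_preimage, not_le]
  rw [rank_eq_finrank_range_toEuclideanLin, ← Nat.succ_le_iff, LinearMap.rank,
    ← Module.finrank_eq_rank, Nat.cast_le]
  rfl

theorem rank_single_le [DecidableEq m] [DecidableEq n] (i : m) (j : n) (c : 𝕜) :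
    (single i j c).rank ≤ 1 := by
  have h : single i j c = vecMulVec (Pi.single i c) (Pi.single j 1) := by
    rw [← mul_one c, ← smul_eq_mul, ← smul_single, single_eq_single_vecMulVec_single,
      ← smul_vecMulVec, ← Pi.single_smul]
  rw [h]
  exact rank_vecMulVec_le _ _

theorem convexHull_setOf_rank_le [Finite m] {K : ℕ} (hK : 1 ≤ K) :
    convexHull ℝ {X : Matrix m n 𝕜 | X.rank ≤ K} = univ := by
  cases nonempty_fintype m
  classical
  refine eq_univ_of_forall fun X ↦ ?_
  suffices h : ∀ c : ℝ, c • X ∈ convexHull ℝ {X : Matrix m n 𝕜 | X.rank ≤ K} by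
    simpa only [one_smul] using h 1
  induction X using Matrix.induction_on' with
  | h_zero =>
    refine fun c ↦ subset_convexHull ℝ _ ?_
    rw [smul_zero, mem_ofPred_eq, rank_zero]
    exact zero_le
  | h_add X Y hX hY =>
    intro c
    have hmid := convex_convexHull ℝ {X : Matrix m n 𝕜 | X.rank ≤ K} (hX (2 * c)) (hY (2 * c))
      one_half_pos.le one_half_pos.le (add_halves 1)
    convert hmid using 1
    module
  | h_std_basis i j x =>
    intro c
    rw [smul_single]
    exact subset_convexHull ℝ _ ((rank_single_le i j _).trans hK)

variable [Fintype m]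

theorem conjTranspose_mul_eq_zero_of_isProximalNormal {X E : Matrix m n 𝕜}
    (h : IsProximalNormal {W | W.rank ≤ X.rank} X E) : Xᴴ * E = 0 := by
  classical
  have horth : inner ℝ E (X * (Xᴴ * E)) = 0 := h.inner_eq_zero fun s ↦ by
    have hfactor : X + s • (X * (Xᴴ * E)) = X * (1 + s • (Xᴴ * E)) := by
      rw [Matrix.mul_add, Matrix.mul_one, Matrix.mul_smul]
    exact hfactor ▸ rank_mul_le_left _ _
  rw [frobenius_inner_eq, ← Matrix.mul_assoc, ← conjTranspose_conjTranspose X,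
    ← conjTranspose_mul, conjTranspose_conjTranspose, re_trace_conjTranspose_mul_self] at horth
  exact norm_eq_zero.1 (pow_eq_zero_iff two_ne_zero |>.1 horth)

theorem mul_conjTranspose_eq_zero_of_isProximalNormal {X E : Matrix m n 𝕜}
    (h : IsProximalNormal {W | W.rank ≤ X.rank} X E) : E * Xᴴ = 0 := by
  classical
  have horth : inner ℝ E (E * Xᴴ * X) = 0 := h.inner_eq_zero fun s ↦ by
    have hfactor : X + s • (E * Xᴴ * X) = (1 + s • (E * Xᴴ)) * X := by
      rw [Matrix.add_mul, Matrix.one_mul, Matrix.smul_mul]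
    exact hfactor ▸ rank_mul_le_right _ _
  rw [frobenius_inner_eq, ← Matrix.mul_assoc, trace_mul_comm, ← Matrix.mul_assoc,
    ← conjTranspose_conjTranspose X, ← conjTranspose_mul, conjTranspose_conjTranspose,
    re_trace_conjTranspose_mul_self] at horth
  exact norm_eq_zero.1 (pow_eq_zero_iff two_ne_zero |>.1 horth)

variable [DecidableEq n]

theorem norm_mul_rowProj_le_norm_mul_one_sub_rowProj {X E W : Matrix m n 𝕜} {α : ℝ}
    (hEX : E * Xᴴ = 0) (hE : ‖E‖ ≤ α)
    (hbound : ∀ v ∈ (LinearMap.ker (toEuclideanLin X))ᗮ, α * ‖v‖ ≤ ‖toEuclideanLin X v‖)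
    (hW : W.rank ≤ X.rank) : ‖E * rowProj W‖ ≤ ‖X * (1 - rowProj W)‖ := by
  have hQ := isStarProjection_rowProj W
  have hR := isStarProjection_rowProj X
  have hα : 0 ≤ α := (norm_nonneg E).trans hE
  have hQR : ‖rowProj W‖ ≤ ‖rowProj X‖ := by
    refine le_of_sq_le_sq ?_ (norm_nonneg _)
    rw [norm_sq_rowProj, norm_sq_rowProj]
    exact_mod_cast hW
  calc ‖E * rowProj W‖ = ‖E * ((1 - rowProj X) * rowProj W)‖ := by
        rw [← Matrix.mul_assoc, Matrix.mul_sub, Matrix.mul_one, mul_rowProj_eq_zero hEX, sub_zero]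
    _ ≤ ‖E‖ * ‖(1 - rowProj X) * rowProj W‖ := frobenius_norm_mul _ _
    _ = ‖E‖ * ‖rowProj W * (1 - rowProj X)‖ := by
        rw [norm_mul_comm_of_isStarProjection hR.one_sub hQ]
    _ ≤ α * ‖rowProj X * (1 - rowProj W)‖ :=
        mul_le_mul hE (norm_mul_one_sub_le_norm_mul_one_sub hQ hR hQR) (norm_nonneg _) hα
    _ ≤ ‖X * (1 - rowProj W)‖ := norm_mul_rowProj_le hα hbound _

/-- A form of the Eckart–Young theorem: the singular values of `X` dominate those of `E`, so `X` is
a best approximation of `X + E` among the matrices of its rank. -/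
theorem isProximalNormal_of_norm_le {X E : Matrix m n 𝕜} {α : ℝ} (hXE : Xᴴ * E = 0)
    (hEX : E * Xᴴ = 0) (hE : ‖E‖ ≤ α)
    (hbound : ∀ v ∈ (LinearMap.ker (toEuclideanLin X))ᗮ, α * ‖v‖ ≤ ‖toEuclideanLin X v‖) :
    IsProximalNormal {W | W.rank ≤ X.rank} X E := by
  intro W hW
  have hQ := isStarProjection_rowProj W
  have hWQ : W * (1 - rowProj W) = 0 := by
    rw [Matrix.mul_sub, Matrix.mul_one, mul_rowProj, sub_self]
  have hEQ := pow_le_pow_left₀ (norm_nonneg _)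
    (norm_mul_rowProj_le_norm_mul_one_sub_rowProj hEX hE hbound hW) 2
  refine le_of_sq_le_sq ?_ (norm_nonneg _)
  calc ‖E‖ ^ 2 = ‖E * rowProj W‖ ^ 2 + ‖E * (1 - rowProj W)‖ ^ 2 :=
        (norm_sq_mul_add_norm_sq_mul_one_sub hQ E).symm
    _ ≤ ‖X * (1 - rowProj W)‖ ^ 2 + ‖E * (1 - rowProj W)‖ ^ 2 := by gcongr
    _ = ‖(X + E) * (1 - rowProj W)‖ ^ 2 :=
        (norm_sq_add_mul_of_conjTranspose_mul_eq_zero hXE _).symm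
    _ = ‖(X + E - W) * (1 - rowProj W)‖ ^ 2 := by rw [Matrix.sub_mul _ W, hWQ, sub_zero]
    _ ≤ ‖X + E - W‖ ^ 2 := pow_le_pow_left₀ (norm_nonneg _) (norm_mul_one_sub_le hQ _) 2

theorem IsProximalNormal.smul_of_norm_le {X E : Matrix m n 𝕜} {α τ : ℝ}
    (h : IsProximalNormal {W | W.rank ≤ X.rank} X E) (hτ : ‖τ • E‖ ≤ α)
    (hbound : ∀ v ∈ (LinearMap.ker (toEuclideanLin X))ᗮ, α * ‖v‖ ≤ ‖toEuclideanLin X v‖) :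
    IsProximalNormal {W | W.rank ≤ X.rank} X (τ • E) := by
  refine isProximalNormal_of_norm_le ?_ ?_ hτ hbound
  · rw [Matrix.mul_smul, conjTranspose_mul_eq_zero_of_isProximalNormal h, smul_zero]
  · rw [Matrix.smul_mul, mul_conjTranspose_eq_zero_of_isProximalNormal h, smul_zero]

theorem rank_eq_and_norm_le_of_norm_sub_lt {X X₀ : Matrix m n 𝕜} {j : ℕ} (hX : X.rank ≤ j + 1)
    (hlt : ‖X - X₀‖ < (toEuclideanLin X₀).singularValues j) :
    X.rank = j + 1 ∧ ∀ v ∈ (LinearMap.ker (toEuclideanLin X))ᗮ,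
      ((toEuclideanLin X₀).singularValues j - ‖X - X₀‖) * ‖v‖ ≤ ‖toEuclideanLin X v‖ := by
  have hj : j < Module.finrank 𝕜 (EuclideanSpace 𝕜 n) := by
    by_contra! h
    rw [LinearMap.singularValues_of_finrank_le _ h] at hlt
    exact hlt.not_ge (norm_nonneg _)
  obtain ⟨S, hS, hSX₀⟩ := exists_finrank_eq_and_singularValues_mul_norm_le (toEuclideanLin X₀) hj
  have hSX : ∀ v ∈ S, ((toEuclideanLin X₀).singularValues j - ‖X - X₀‖) * ‖v‖
      ≤ ‖toEuclideanLin X v‖ := by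
    intro v hv
    have hdiff := norm_toEuclideanLin_apply_le (X - X₀) v
    have htri := norm_sub_le (toEuclideanLin X v) (toEuclideanLin (X - X₀) v)
    rw [map_sub, LinearMap.sub_apply, sub_sub_cancel] at htri
    rw [map_sub, LinearMap.sub_apply] at hdiff
    rw [sub_mul]
    linarith [hSX₀ v hv]
  have hle := finrank_le_finrank_range_of_norm_le (sub_pos.2 hlt) hSX
  rw [hS, ← rank_eq_finrank_range_toEuclideanLin] at hle
  refine ⟨hX.antisymm hle, fun v ↦ norm_le_of_mem_ker_orthogonal (sub_pos.2 hlt) hSX ?_⟩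
  rwa [hS, ← rank_eq_finrank_range_toEuclideanLin]

end RankApproximation

section Recovery

open Matrix

theorem norm_map_le_of_opNorm_le_one {V W : Type*} [NormedAddCommGroup V] [NormedSpace ℝ V]
    [FiniteDimensional ℝ V] [NormedAddCommGroup W] [NormedSpace ℝ W] {A : V →ₗ[ℝ] W}
    (hA : opNorm A ≤ 1) (D : V) : ‖A D‖ ≤ ‖D‖ :=
  ((LinearMap.toContinuousLinearMap A).le_opNorm D).trans
    (mul_le_of_le_one_left (norm_nonneg D) hA)

theorem norm_map_lt_of_opNorm_lt_one {V W : Type*} [NormedAddCommGroup V] [NormedSpace ℝ V]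
    [FiniteDimensional ℝ V] [NormedAddCommGroup W] [NormedSpace ℝ W] {A : V →ₗ[ℝ] W}
    (hA : opNorm A < 1) {D : V} (hD : D ≠ 0) : ‖A D‖ < ‖D‖ :=
  ((LinearMap.toContinuousLinearMap A).le_opNorm D).trans_lt
    (mul_lt_of_lt_one_left (norm_pos_iff.2 hD) hA)

theorem exists_gt_mul_le {κ e α : ℝ} (he : 0 ≤ e) (h : κ * e < α) : ∃ τ > κ, τ * e ≤ α := by
  rcases he.eq_or_lt with rfl | he
  · exact ⟨κ + 1, lt_add_one κ, by simpa using h.le⟩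
  · exact ⟨α / e, (lt_div_iff₀ he).2 h, (div_mul_cancel₀ α he.ne').le⟩

theorem inv_add_two_div_sqrt_le {δ : ℝ} (hδ₀ : 0 ≤ δ) (hδ : δ < 1 / 2) :
    (1 - 2 * δ)⁻¹ + 2 / √(1 - δ) ≤ 5 / (1 - 2 * δ) ^ (3 / 2 : ℝ) := by
  have hu : 0 < 1 - 2 * δ := by linarith
  have hu1 : 1 - 2 * δ ≤ 1 := by linarith
  have hle : (1 - 2 * δ) ^ (3 / 2 : ℝ) ≤ 1 - 2 * δ := by
    simpa only [Real.rpow_one] using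
      Real.rpow_le_rpow_of_exponent_ge hu hu1 (by norm_num : (1 : ℝ) ≤ 3 / 2)
  have hle_sqrt : (1 - 2 * δ) ^ (3 / 2 : ℝ) ≤ √(1 - δ) := by
    calc (1 - 2 * δ) ^ (3 / 2 : ℝ) ≤ (1 - 2 * δ) ^ (1 / 2 : ℝ) :=
          Real.rpow_le_rpow_of_exponent_ge hu hu1 (by norm_num)
      _ = √(1 - 2 * δ) := (Real.sqrt_eq_rpow _).symm
      _ ≤ √(1 - δ) := Real.sqrt_le_sqrt (by linarith)
  calc (1 - 2 * δ)⁻¹ + 2 / √(1 - δ)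
      ≤ ((1 - 2 * δ) ^ (3 / 2 : ℝ))⁻¹ + 2 / (1 - 2 * δ) ^ (3 / 2 : ℝ) := by gcongr
    _ = 3 / (1 - 2 * δ) ^ (3 / 2 : ℝ) := by ring
    _ ≤ 5 / (1 - 2 * δ) ^ (3 / 2 : ℝ) := by gcongr; norm_num

variable {𝕜 : Type*} [RCLike 𝕜] {n₁ n₂ : ℕ} {H : Type*} [NormedAddCommGroup H]
  [InnerProductSpace ℝ H] {A : Matrix (Fin n₁) (Fin n₂) 𝕜 →ₗ[ℝ] H} {b ε : H}
  {X X₀ Y : Matrix (Fin n₁) (Fin n₂) 𝕜} {k K : ℕ}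

theorem one_sub_lrip_mul_norm_sq_le (A : Matrix (Fin n₁) (Fin n₂) 𝕜 →ₗ[ℝ] H)
    (hX : X.rank ≤ k) : (1 - lrip A k) * ‖X‖ ^ 2 ≤ ‖A X‖ ^ 2 := by
  rcases eq_or_ne X 0 with rfl | h0
  · simp
  rw [← le_div_iff₀ (by have := norm_pos_iff.2 h0; positivity), lrip, sub_sub_cancel]
  refine csInf_le ⟨0, ?_⟩ ⟨X, h0, hX, rfl⟩
  rintro _ ⟨Y, -, -, rfl⟩
  positivity

theorem sqrt_one_sub_lrip_mul_norm_le (A : Matrix (Fin n₁) (Fin n₂) 𝕜 →ₗ[ℝ] H)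
    (hX : X.rank ≤ k) : √(1 - lrip A k) * ‖X‖ ≤ ‖A X‖ := by
  have h := Real.sqrt_le_sqrt (one_sub_lrip_mul_norm_sq_le A hX)
  rwa [Real.sqrt_mul' _ (sq_nonneg _), Real.sqrt_sq (norm_nonneg _),
    Real.sqrt_sq (norm_nonneg _)] at h

theorem lrip_nonneg (hA : opNorm A ≤ 1) : 0 ≤ lrip A k := by
  by_cases h : ∃ X : Matrix (Fin n₁) (Fin n₂) 𝕜, X ≠ 0 ∧ X.rank ≤ k
  · obtain ⟨X, hX₀, hX⟩ := h
    have hlow := one_sub_lrip_mul_norm_sq_le A hX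
    have hup := pow_le_pow_left₀ (norm_nonneg _) (norm_map_le_of_opNorm_le_one hA X) 2
    have hle : 1 - lrip A k ≤ 1 :=
      le_of_mul_le_mul_right (by linarith) (pow_pos (norm_pos_iff.2 hX₀) 2)
    linarith
  · have hempty : {r : ℝ | ∃ X : Matrix (Fin n₁) (Fin n₂) 𝕜,
        X ≠ 0 ∧ X.rank ≤ k ∧ r = ‖A X‖ ^ 2 / ‖X‖ ^ 2} = ∅ :=
      eq_empty_of_forall_notMem fun _ ⟨X, hX₀, hX, _⟩ ↦ h ⟨X, hX₀, hX⟩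
    rw [lrip, hempty, Real.sInf_empty, sub_zero]
    exact zero_le_one

theorem exists_isBestRank (hδ : lrip A k < 1) (hK : K ≤ k) (b : H) : ∃ X, IsBestRank A b K X := by
  have hc : 0 < √(1 - lrip A k) := Real.sqrt_pos.2 (sub_pos.2 hδ)
  have hcont : Continuous fun X ↦ ‖A X - b‖ :=
    (A.continuous_of_finiteDimensional.sub continuous_const).norm
  have hcoercive : ∀ᶠ X in Filter.cocompact (Matrix (Fin n₁) (Fin n₂) 𝕜) ⊓
      Filter.principal {X | X.rank ≤ K}, ‖A 0 - b‖ ≤ ‖A X - b‖ := by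
    rw [Filter.eventually_inf_principal]
    filter_upwards [(tendsto_norm_cocompact_atTop
      (E := Matrix (Fin n₁) (Fin n₂) 𝕜)).eventually_ge_atTop (2 * ‖b‖ / √(1 - lrip A k))]
      with X hX hXr
    rw [div_le_iff₀' hc] at hX
    rw [map_zero, zero_sub, norm_neg]
    linarith [sqrt_one_sub_lrip_mul_norm_le A (hXr.trans hK), norm_sub_norm_le (A X) b]
  obtain ⟨X, hX, hmin⟩ := hcont.continuousOn.exists_isMinOn' (isClosed_setOf_rank_le K)
    (by simp) hcoercive
  exact ⟨X, hX, fun Y hY ↦ hmin hY⟩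

theorem IsBestRank.norm_sub_le (hX : IsBestRank A b K X) (hb : b = A X₀ + ε)
    (hX₀ : X₀.rank ≤ K) : ‖A X - b‖ ≤ ‖ε‖ := by
  simpa only [hb, sub_add_cancel_left, norm_neg] using hX.2 X₀ hX₀

theorem IsBestRank.norm_sub_le_div (hX : IsBestRank A b K X) (hb : b = A X₀ + ε)
    (hX₀ : X₀.rank ≤ K) (hδ : lrip A (2 * K) < 1) :
    ‖X - X₀‖ ≤ 2 * ‖ε‖ / √(1 - lrip A (2 * K)) := by
  rw [le_div_iff₀' (Real.sqrt_pos.2 (sub_pos.2 hδ))]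
  have hrank : (X - X₀).rank ≤ 2 * K := (rank_sub_le X X₀).trans (by linarith [hX.1])
  calc √(1 - lrip A (2 * K)) * ‖X - X₀‖ ≤ ‖A (X - X₀)‖ := sqrt_one_sub_lrip_mul_norm_le A hrank
    _ = ‖A X - b + ε‖ := by rw [map_sub, hb, sub_add_eq_sub_sub, sub_add_cancel]
    _ ≤ ‖A X - b‖ + ‖ε‖ := norm_add_le _ _
    _ ≤ 2 * ‖ε‖ := by linarith [hX.norm_sub_le hb hX₀]

attribute [local instance] frobeniusInnerProductSpace

theorem regFunctional_eq_envelopeLeastSquares (A : Matrix (Fin n₁) (Fin n₂) 𝕜 →ₗ[ℝ] H) (b : H)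
    (K : ℕ) : regFunctional A b K = envelopeLeastSquares {X | X.rank ≤ K} A b := by
  have h : rankIndicator K = setIndicator {X : Matrix (Fin n₁) (Fin n₂) 𝕜 | X.rank ≤ K} := by
    ext X
    simp only [rankIndicator, setIndicator, mem_ofPred_eq]
    split_ifs <;> rfl
  ext X
  rw [regFunctional, h, envelopeLeastSquares]

theorem IsBestRank.regFunctional_le (hX : IsBestRank A b K X) (hA : opNorm A ≤ 1)
    (Y : Matrix (Fin n₁) (Fin n₂) 𝕜) : regFunctional A b K X ≤ regFunctional A b K Y := by
  rw [regFunctional_eq_envelopeLeastSquares]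
  exact envelopeLeastSquares_le_of_forall_le (isClosed_setOf_rank_le K)
    (norm_map_le_of_opNorm_le_one hA) hX.1 hX.2 Y

theorem rank_le_and_isProximalNormal_of_isLocalMin (hK : 1 ≤ K) (hA : opNorm A < 1)
    (hY : IsLocalMin (regFunctional A b K) Y) :
    Y.rank ≤ K ∧ IsProximalNormal {W | W.rank ≤ K} Y (descentDir A b Y) := by
  have hAD : ∀ D ≠ 0, ‖A D‖ < ‖D‖ := fun D hD ↦ norm_map_lt_of_opNorm_lt_one hA hD
  have hC : IsClosed {W : Matrix (Fin n₁) (Fin n₂) 𝕜 | W.rank ≤ K} := isClosed_setOf_rank_le K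
  have hY' : IsLocalMin (envelopeLeastSquares {W | W.rank ≤ K} A b) Y := by
    rwa [← regFunctional_eq_envelopeLeastSquares]
  exact mem_and_isProximalNormal_of_isLocalMin hC (convexHull_setOf_rank_le hK) hAD hY'

/-- The surplus of the singular values of `X` over the residual leaves room to lengthen its
proximal normal by a factor `τ > (1 - 2δ)⁻¹`. -/
theorem IsBestRank.eq_of_isLocalMin (hX : IsBestRank A b K X) (hK : 1 ≤ K) (hA : opNorm A < 1)
    (hδ : lrip A (2 * K) < 1 / 2)
    (hσ : (1 - 2 * lrip A (2 * K))⁻¹ * ‖A X - b‖ + ‖X - X₀‖ < sigma X₀ K)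
    (hY : IsLocalMin (regFunctional A b K) Y) : Y = X := by
  have hu : 0 < 1 - 2 * lrip A (2 * K) := by linarith
  obtain ⟨j, rfl⟩ := Nat.exists_eq_add_of_le' hK
  obtain ⟨hYmem, hnY⟩ := rank_le_and_isProximalNormal_of_isLocalMin hK hA hY
  have hnX := (rank_le_and_isProximalNormal_of_isLocalMin hK hA
    (Filter.Eventually.of_forall (hX.regFunctional_le hA.le))).2
  obtain ⟨τ, hτ, hτE⟩ := exists_gt_mul_le (norm_nonneg (A X - b)) (lt_sub_iff_add_lt.2 hσ)
  have hτ₀ : 0 < τ := (inv_pos.2 hu).trans hτ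
  have hlt : ‖X - X₀‖ < sigma X₀ (j + 1) :=
    (le_add_of_nonneg_left (by positivity)).trans_lt hσ
  obtain ⟨hrank, hbound⟩ := rank_eq_and_norm_le_of_norm_sub_lt hX.1 hlt
  have hτnorm : ‖τ • descentDir A b X‖ ≤ sigma X₀ (j + 1) - ‖X - X₀‖ := by
    rw [norm_smul, Real.norm_of_nonneg hτ₀.le]
    exact (mul_le_mul_of_nonneg_left
      (norm_descentDir_le (norm_map_le_of_opNorm_le_one hA.le) b X) hτ₀.le).trans hτE
  have hYX : (Y - X).rank ≤ 2 * (j + 1) := (rank_sub_le Y X).trans (by linarith [hX.1])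
  rw [← hrank] at hnX hnY hYmem
  refine eq_of_isProximalNormal (mem_ofPred_eq ▸ le_rfl) hYmem
    (hnX.smul_of_norm_le hτnorm hbound) hnY (one_sub_lrip_mul_norm_sq_le A hYX) hτ₀.le ?_
  linarith [(inv_lt_iff_one_lt_mul₀ hu).1 hτ]

end Recovery

end LowRank

theorem theorem6p4_general {𝕜 : Type*} [RCLike 𝕜] {n₁ n₂ : ℕ}
    {H : Type*} [NormedAddCommGroup H] [InnerProductSpace ℝ H]
    (A : Matrix (Fin n₁) (Fin n₂) 𝕜 →ₗ[ℝ] H) (b ε : H)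
    (X₀ : Matrix (Fin n₁) (Fin n₂) 𝕜) (K : ℕ) (hK : 1 ≤ K)
    (hb : b = A X₀ + ε) (hA : LowRank.opNorm A < 1)
    (hδ : LowRank.lrip A (2 * K) < 1 / 2)
    (hrank : X₀.rank ≤ K)
    (hσ : ((1 - 2 * LowRank.lrip A (2 * K))⁻¹ + 2 / √(1 - LowRank.lrip A (2 * K))) * ‖ε‖
      < LowRank.sigma X₀ K) :
    ∃ X_B : Matrix (Fin n₁) (Fin n₂) 𝕜,
      (∀ X, LowRank.IsBestRank A b K X ↔ X = X_B) ∧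
      (∀ X, (∀ Y, LowRank.regFunctional A b K X ≤ LowRank.regFunctional A b K Y) ↔ X = X_B) ∧
      (∀ X, IsLocalMin (LowRank.regFunctional A b K) X → X = X_B) ∧
      ‖X_B - X₀‖ ≤ 2 * ‖ε‖ / √(1 - LowRank.lrip A (2 * K)) := by
  have hδ₁ : LowRank.lrip A (2 * K) < 1 := by linarith
  obtain ⟨X, hX⟩ := LowRank.exists_isBestRank hδ₁ (Nat.le_mul_of_pos_left K two_pos) b
  have hdist := hX.norm_sub_le_div hb hrank hδ₁
  have hgap : (1 - 2 * LowRank.lrip A (2 * K))⁻¹ * ‖A X - b‖ + ‖X - X₀‖ < LowRank.sigma X₀ K := by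
    have hres := mul_le_mul_of_nonneg_left (hX.norm_sub_le hb hrank)
      (inv_nonneg.2 (by linarith : 0 ≤ 1 - 2 * LowRank.lrip A (2 * K)))
    rw [add_mul, div_mul_eq_mul_div] at hσ
    linarith
  have hlocal : ∀ Y, IsLocalMin (LowRank.regFunctional A b K) Y → Y = X :=
    fun Y ↦ hX.eq_of_isLocalMin hK hA hδ hgap
  have hglobal : ∀ Y, (∀ Z, LowRank.regFunctional A b K Y ≤ LowRank.regFunctional A b K Z) →
      Y = X := fun Y hY ↦ hlocal Y (Filter.Eventually.of_forall hY)
  refine ⟨X, fun Y ↦ ⟨fun hY ↦ hglobal Y (hY.regFunctional_le hA.le), ?_⟩,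
    fun Y ↦ ⟨hglobal Y, ?_⟩, hlocal, hdist⟩
  · rintro rfl
    exact hX
  · rintro rfl
    exact hX.regFunctional_le hA.le

theorem theorem6p4 {𝕜 : Type*} [RCLike 𝕜] {n₁ n₂ : ℕ}
    {H : Type*} [NormedAddCommGroup H] [InnerProductSpace ℝ H] [FiniteDimensional ℝ H]
    (A : Matrix (Fin n₁) (Fin n₂) 𝕜 →ₗ[ℝ] H) (b ε : H)
    (X₀ : Matrix (Fin n₁) (Fin n₂) 𝕜) (K : ℕ) (hK : 1 ≤ K)
    (hb : b = A X₀ + ε) (hA : LowRank.opNorm A < 1)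
    (hδ : LowRank.lrip A (2 * K) < 1 / 2)
    (hrank : X₀.rank = K)
    (hσ : LowRank.sigma X₀ K > 5 / (1 - 2 * LowRank.lrip A (2 * K)) ^ (3 / 2 : ℝ) * ‖ε‖) :
    ∃ X_B : Matrix (Fin n₁) (Fin n₂) 𝕜,
      (∀ X, LowRank.IsBestRank A b K X ↔ X = X_B) ∧
      (∀ X, (∀ Y, LowRank.regFunctional A b K X ≤ LowRank.regFunctional A b K Y) ↔ X = X_B) ∧
      (∀ X, IsLocalMin (LowRank.regFunctional A b K) X → X = X_B) ∧
      ‖X_B - X₀‖ ≤ 2 * ‖ε‖ / √(1 - LowRank.lrip A (2 * K)) :=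
  theorem6p4_general A b ε X₀ K hK hb hA hδ hrank.le <|
    (mul_le_mul_of_nonneg_right
      (LowRank.inv_add_two_div_sqrt_le (LowRank.lrip_nonneg hA.le) hδ) (norm_nonneg ε)).trans_lt hσ
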